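/- Let $\Omega$ be an infinite procyclic group, i.e. an infinite topological group that is (topologically isomorphic to) an inverse limit of finite cyclic groups carrying the discrete topology. Let $T:\Omega\to\Omega$ be a minimal translation, i.e. $T(\omega)=\omega\cdot\omega_0$ for some fixed $\omega_0\in\Omega$, and for every $\omega\in\Omega$ the orbit $\{T^n(\omega):n\in\mathbb Z\}$ is dense in $\Omega$. For $f\in C(\Omega,\mathbb R)$ and $\omega\in\Omega$ let $H_\omega$ be the bounded operator on $\ell^2(\mathbb Z)$ given by $$(H_\omega\psi)(n)=\psi(n+1)+\psi(n-1)+f(T^n(\omega))\,\psi(n),\qquad n\in\mathbb Z.$$ Then there is a dense $G_\delta$ set $\mathcal C\subseteq C(\Omega,\mathbb R)$ (with respect to the uniform norm) such that for every $f\in\mathcal C$ and every $\omega\in\Omega$ the spectrum of $H_\omega$ is a Cantor set, i.e. a nonempty compact subset of $\mathbb R$ with empty interior and without isolated points. -/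

import Mathlib

open scoped ENNReal BoundedContinuousFunction

universe u

/-! ### Procyclic groups -/

/-- An inverse system of finite cyclic groups (with the discrete topology) over a preordered
index set. -/
structure CyclicInverseSystem (I : Type u) [Preorder I] where
  /-- The groups of the system. -/
  X : I → Type u
  [group : ∀ i, Group (X i)]
  [topology : ∀ i, TopologicalSpace (X i)]
  [discrete : ∀ i, DiscreteTopology (X i)]
  [finite : ∀ i, Finite (X i)]
  [cyclic : ∀ i, IsCyclic (X i)]
  /-- The transition homomorphisms. -/
  map : ∀ {i j : I}, i ≤ j → X j →* X i
  map_refl : ∀ i : I, map (le_refl i) = MonoidHom.id (X i)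
  map_comp : ∀ {i j k : I} (hij : i ≤ j) (hjk : j ≤ k),
    (map hij).comp (map hjk) = map (hij.trans hjk)

attribute [instance] CyclicInverseSystem.group CyclicInverseSystem.topology
  CyclicInverseSystem.discrete CyclicInverseSystem.finite CyclicInverseSystem.cyclic

/-- The inverse limit of the system: the subgroup of compatible families in the product
`∏ i, X i`, carrying the topology induced by the product topology. -/
def CyclicInverseSystem.limit {I : Type u} [Preorder I] (S : CyclicInverseSystem I) :
    Subgroup (∀ i, S.X i) where
  carrier := {c | ∀ (i j : I) (hij : i ≤ j), S.map hij (c j) = c i}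
  mul_mem' := by
    intro a b ha hb i j hij
    simp [ha i j hij, hb i j hij]
  one_mem' := by
    intro i j hij
    simp
  inv_mem' := by
    intro a ha i j hij
    simp [ha i j hij]

/-- A procyclic group is a topological group that is isomorphic, as a topological group, to the
inverse limit of an inverse system of finite cyclic groups over a directed partially ordered set.
(A family of representatives of all such index sets lives in the universe of `G`: one may always
take the open normal subgroups of `G` and the corresponding quotients.) -/
def IsProcyclic (G : Type u) [Group G] [TopologicalSpace G] : Prop :=
  ∃ (I : Type u) (_ : PartialOrder I) (_ : Nonempty I) (_ : IsDirectedOrder I)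
    (S : CyclicInverseSystem I), Nonempty (G ≃ₜ* S.limit)

/-! ### Minimal translations -/

/-- `T` is a translation `ω ↦ ω * ω₀` of the group, and the two-sided orbit of every point is
dense. -/
structure IsMinimalTranslation {G : Type u} [Group G] [TopologicalSpace G]
    (T : Equiv.Perm G) : Prop where
  translation : ∃ ω₀ : G, ∀ ω : G, T ω = ω * ω₀
  minimal : ∀ ω : G, Dense (Set.range fun n : ℤ => (T ^ n) ω)

/-! ### Discrete Schrödinger operators on `ℓ²(ℤ)` -/

/-- The complex Hilbert space `ℓ²(ℤ)`. -/
abbrev EllTwoZ : Type := lp (fun _ : ℤ => ℂ) 2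

theorem ellTwoZ_memℓp_iff (ψ : ℤ → ℂ) :
    Memℓp ψ 2 ↔ Summable fun n => ‖ψ n‖ ^ (2 : ℕ) := by
  rw [memℓp_gen_iff (by norm_num)]
  norm_num

theorem ellTwoZ_norm_sq (ψ : EllTwoZ) : ‖ψ‖ ^ (2 : ℕ) = ∑' n, ‖ψ n‖ ^ (2 : ℕ) := by
  have h := lp.norm_rpow_eq_tsum (p := 2) (by norm_num) ψ
  norm_num at h
  exact h

theorem ellTwoZ_summable (ψ : EllTwoZ) : Summable fun n => ‖ψ n‖ ^ (2 : ℕ) :=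
  (ellTwoZ_memℓp_iff _).1 (lp.memℓp ψ)

/-- The shift `(shiftOp k ψ)(n) = ψ (n + k)` on `ℓ²(ℤ)`. -/
noncomputable def shiftOp (k : ℤ) : EllTwoZ →L[ℂ] EllTwoZ :=
  LinearMap.mkContinuous
    { toFun := fun ψ => ⟨fun n => ψ (n + k), (ellTwoZ_memℓp_iff _).2
        ((Equiv.addRight k).summable_iff.2 (ellTwoZ_summable ψ))⟩
      map_add' := fun _ _ => rfl
      map_smul' := fun _ _ => rfl } 1 (by
    intro ψ
    rw [one_mul]
    refine le_of_eq ((sq_eq_sq₀ (norm_nonneg _) (norm_nonneg _)).1 ?_)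
    rw [ellTwoZ_norm_sq, ellTwoZ_norm_sq]
    exact (Equiv.addRight k).tsum_eq fun n => ‖ψ n‖ ^ (2 : ℕ))

theorem mulOp_bound (V : ℤ →ᵇ ℝ) (ψ : EllTwoZ) (n : ℤ) :
    ‖(V n : ℂ) * ψ n‖ ^ (2 : ℕ) ≤ ‖V‖ ^ (2 : ℕ) * ‖ψ n‖ ^ (2 : ℕ) := by
  rw [norm_mul, mul_pow, Complex.norm_real]
  gcongr
  exact V.norm_coe_le_norm n

theorem mulOp_summable (V : ℤ →ᵇ ℝ) (ψ : EllTwoZ) :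
    Summable fun n => ‖(V n : ℂ) * ψ n‖ ^ (2 : ℕ) :=
  Summable.of_nonneg_of_le (fun _ => by positivity) (mulOp_bound V ψ)
    ((ellTwoZ_summable ψ).mul_left _)

/-- The multiplication operator `(mulOp V ψ)(n) = V n * ψ n` by a bounded real potential. -/
noncomputable def mulOp (V : ℤ →ᵇ ℝ) : EllTwoZ →L[ℂ] EllTwoZ :=
  LinearMap.mkContinuous
    { toFun := fun ψ => ⟨fun n => (V n : ℂ) * ψ n,
        (ellTwoZ_memℓp_iff _).2 (mulOp_summable V ψ)⟩
      map_add' := fun ψ φ => by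
        ext n
        exact mul_add (V n : ℂ) (ψ n) (φ n)
      map_smul' := fun c ψ => by
        ext n
        exact mul_left_comm (V n : ℂ) c (ψ n) } ‖V‖ (by
    intro ψ
    refine (sq_le_sq₀ (norm_nonneg _) (by positivity)).1 ?_
    rw [mul_pow, ellTwoZ_norm_sq, ellTwoZ_norm_sq, ← tsum_mul_left]
    exact (mulOp_summable V ψ).tsum_le_tsum (mulOp_bound V ψ)
      ((ellTwoZ_summable ψ).mul_left _))

/-- The discrete Schrödinger operator on `ℓ²(ℤ)` with bounded real potential `V`. -/
noncomputable def schrodingerOp (V : ℤ →ᵇ ℝ) : EllTwoZ →L[ℂ] EllTwoZ :=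
  shiftOp 1 + shiftOp (-1) + mulOp V

theorem schrodingerOp_apply (V : ℤ →ᵇ ℝ) (ψ : EllTwoZ) (n : ℤ) :
    schrodingerOp V ψ n = ψ (n + 1) + ψ (n - 1) + V n * ψ n := rfl

/-- The potential `n ↦ f (T ^ n ω)` obtained by sampling `f` along the orbit of `ω`. -/
noncomputable def sampledPotential {Ω : Type u} [TopologicalSpace Ω] [CompactSpace Ω]
    (T : Equiv.Perm Ω) (f : C(Ω, ℝ)) (ω : Ω) : ℤ →ᵇ ℝ :=
  (BoundedContinuousFunction.mkOfCompact f).compContinuous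
    ⟨fun n : ℤ => (T ^ n) ω, continuous_of_discreteTopology⟩

theorem sampledPotential_apply {Ω : Type u} [TopologicalSpace Ω] [CompactSpace Ω]
    (T : Equiv.Perm Ω) (f : C(Ω, ℝ)) (ω : Ω) (n : ℤ) :
    sampledPotential T f ω n = f ((T ^ n) ω) := rfl

/-! ### Cantor sets -/

/-- A Cantor subset of the real line: nonempty, compact, with empty interior and without isolated
points. -/
structure IsCantorSet (K : Set ℝ) : Prop where
  nonempty : K.Nonempty
  isCompact : IsCompact K
  interior_eq_empty : interior K = ∅
  preperfect : Preperfect K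

/-! The spectrum of a bounded self-adjoint operator is a nonempty compact subset of the line, so
only interior and isolated points have to be excluded. It is also the same for all `ω`: a translate
of the potential gives a conjugate operator, invertibility is an open condition, and orbits are
dense (`spectrum_sampledPotential_eq`).

Interior is excluded generically, by Baire. For each rational interval, the `f` whose spectrum
misses some point of it form an open set; density is `exists_near_gap`. There `f` is approximated by
a function invariant under an open normal subgroup, whose sampled potential is periodic. If its
spectrum fills the interval, Floquet theory gives, for every large multiple of the period, an energy
in the interval with monodromy `±1` (`exists_monodromy_eq_smul_one`). A small change at two adjacent
sites per period pushes the trace at that energy beyond 2 in absolute value, which opens a gap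
(`not_mem_spectrum_of_perturbation`).

Isolated points occur for no `f` (`accPt_spectrum_of_recurrent`). Such a point would be an
eigenvalue with an eigenspace of dimension at most two. Shifting an eigenvector by a large
almost-period of the potential nearly keeps it in this eigenspace, yet makes it tiny at the sites 0
and 1, which control the norm there. -/

/-! ### Transfer matrices of three-term recurrences -/

section TransferMatrix

variable {R : Type*} [CommRing R]

/-- The one-step matrix of the recurrence `u (n + 1) = x * u n - u (n - 1)`. -/
def stepMatrix (x : R) : Matrix (Fin 2) (Fin 2) R := !![x, -1; 1, 0]

/-- The product of the `k` one-step matrices at the sites `n, …, n + k - 1`. -/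
def transferMatrix (x : ℤ → R) : ℕ → ℤ → Matrix (Fin 2) (Fin 2) R
  | 0, _ => 1
  | k + 1, n => stepMatrix (x (n + k)) * transferMatrix x k n

theorem det_stepMatrix (x : R) : (stepMatrix x).det = 1 := by
  simp [stepMatrix, Matrix.det_fin_two]

theorem det_transferMatrix (x : ℤ → R) (k : ℕ) (n : ℤ) : (transferMatrix x k n).det = 1 := by
  induction k with
  | zero => simp [transferMatrix]
  | succ k ih => rw [transferMatrix, Matrix.det_mul, ih, det_stepMatrix, one_mul]

theorem transferMatrix_add (x : ℤ → R) (j k : ℕ) (n : ℤ) :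
    transferMatrix x (j + k) n = transferMatrix x j (n + k) * transferMatrix x k n := by
  induction j with
  | zero => simp [transferMatrix]
  | succ j ih =>
    rw [Nat.add_right_comm, transferMatrix, transferMatrix, ih, Matrix.mul_assoc]
    congr 3
    push_cast
    ring_nf

theorem transferMatrix_congr {x y : ℤ → R} (k : ℕ) (n : ℤ)
    (h : ∀ i : ℕ, i < k → x (n + i) = y (n + i)) :
    transferMatrix x k n = transferMatrix y k n := by
  induction k with
  | zero => rfl
  | succ k ih =>
    rw [transferMatrix, transferMatrix, ih fun i hi => h i (hi.trans k.lt_succ_self),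
      h k k.lt_succ_self]

theorem map_transferMatrix {S : Type*} [CommRing S] (φ : R →+* S) (x : ℤ → R) (k : ℕ) (n : ℤ) :
    φ.mapMatrix (transferMatrix x k n) = transferMatrix (fun m => φ (x m)) k n := by
  induction k with
  | zero => simp [transferMatrix]
  | succ k ih =>
    rw [transferMatrix, transferMatrix, map_mul, ih]
    congr 1
    ext i j
    fin_cases i <;> fin_cases j <;> simp [stepMatrix]

theorem transferMatrix_shift (x : ℤ → R) (k : ℕ) (n m : ℤ)
    (h : ∀ i : ℤ, x (i + m) = x i) : transferMatrix x k (n + m) = transferMatrix x k n := by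
  induction k with
  | zero => rfl
  | succ k ih => rw [transferMatrix, transferMatrix, ih, add_right_comm, h]

theorem transferMatrix_mul_period {x : ℤ → R} {p : ℕ} (h : ∀ i : ℤ, x (i + p) = x i) (q : ℕ)
    (n : ℤ) : transferMatrix x (q * p) n = transferMatrix x p n ^ q := by
  induction q with
  | zero => simp [transferMatrix]
  | succ q ih =>
    rw [Nat.succ_mul, transferMatrix_add, pow_succ, transferMatrix_shift x _ _ _ h, ih]

theorem trace_transferMatrix_succ {x : ℤ → R} {p : ℕ} (h : ∀ i : ℤ, x (i + p) = x i) (n : ℤ) :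
    (transferMatrix x p (n + 1)).trace = (transferMatrix x p n).trace := by
  have h₁ : transferMatrix x p (n + 1) * stepMatrix (x n) =
      stepMatrix (x n) * transferMatrix x p n := by
    have := transferMatrix_add x p 1 n
    rw [transferMatrix, h] at this
    simpa [transferMatrix] using this.symm
  have hu : IsUnit (stepMatrix (x n)).det := by simp [det_stepMatrix]
  have h₂ : transferMatrix x p (n + 1) =
      stepMatrix (x n) * transferMatrix x p n * (stepMatrix (x n))⁻¹ := by
    rw [← h₁, Matrix.mul_assoc, Matrix.mul_nonsing_inv _ hu, Matrix.mul_one]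
  rw [h₂, Matrix.trace_mul_comm, ← Matrix.mul_assoc, Matrix.nonsing_inv_mul _ hu, Matrix.one_mul]

theorem trace_transferMatrix {x : ℤ → R} {p : ℕ} (h : ∀ i : ℤ, x (i + p) = x i) (n : ℤ) :
    (transferMatrix x p n).trace = (transferMatrix x p 0).trace := by
  induction n with
  | zero => rfl
  | succ n ih => rw [trace_transferMatrix_succ h, ih]
  | pred n ih => rw [← ih, ← trace_transferMatrix_succ h (-n - 1), sub_add_cancel]

/-- The values lie in an arbitrary module so that the recurrence can later be solved over `ℂ[X]`,
with functionals on `ℓ²(ℤ)` as unknowns. -/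
theorem transferMatrix_smul {N : Type*} [AddCommGroup N] [Module R N] {x : ℤ → R} {e : ℤ → N}
    (he : ∀ n, e (n + 1) = x n • e n - e (n - 1)) (k : ℕ) (n : ℤ) :
    e (n + k) = transferMatrix x k n 0 0 • e n + transferMatrix x k n 0 1 • e (n - 1) ∧
    e (n + k - 1) = transferMatrix x k n 1 0 • e n + transferMatrix x k n 1 1 • e (n - 1) := by
  induction k with
  | zero => simp [transferMatrix]
  | succ k ih =>
    have h₁ : n + ((k + 1 : ℕ) : ℤ) = n + k + 1 := by push_cast; ring
    rw [h₁, add_sub_cancel_right, he, ih.2]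
    nth_rw 1 [ih.1]
    refine ⟨?_, ?_⟩
    · simp only [transferMatrix, stepMatrix, Matrix.mul_apply, Fin.sum_univ_two, Matrix.of_apply,
        Matrix.cons_val', Matrix.cons_val_zero, Matrix.cons_val_one, Matrix.cons_val_fin_one]
      module
    · rw [ih.1]
      simp only [transferMatrix, stepMatrix, Matrix.mul_apply, Fin.sum_univ_two, Matrix.of_apply,
        Matrix.cons_val', Matrix.cons_val_zero, Matrix.cons_val_one, Matrix.cons_val_fin_one]
      module

/-- Solutions of a `p`-periodic three-term recurrence: the monodromy and its inverse add up to the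
trace of the monodromy. -/
theorem add_period_add_sub_period {N : Type*} [AddCommGroup N] [Module R N] {x : ℤ → R}
    {e : ℤ → N} {p : ℕ} (hx : ∀ i : ℤ, x (i + p) = x i)
    (he : ∀ n, e (n + 1) = x n • e n - e (n - 1)) (n : ℤ) :
    e (n + p) + e (n - p) = (transferMatrix x p 0).trace • e n := by
  rw [← trace_transferMatrix hx n]
  have h₁ := (transferMatrix_smul he p n).1
  have h₂ := transferMatrix_smul he p (n - p)
  rw [← transferMatrix_shift x p (n - p) p hx, sub_add_cancel] at h₂
  have hd := det_transferMatrix x p n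
  rw [Matrix.det_fin_two] at hd
  rw [h₁, Matrix.trace_fin_two]
  set M := transferMatrix x p n
  have h₃ : e (n - p) = M 1 1 • e n - M 0 1 • e (n - 1) := by
    rw [h₂.1, h₂.2]
    calc e (n - p) = (M 0 0 * M 1 1 - M 0 1 * M 1 0) • e (n - p) := by rw [hd, one_smul]
      _ = _ := by module
  rw [h₃]
  module

/-- `B` is `s` times the inverse of the unperturbed product. The inverse of a step matrix has zero
upper left entry, so the terms linear in `t` vanish; the opposite signs of the two changes make the
quadratic term positive. -/
theorem trace_perturbed_monodromy {x₀ x₁ t s : R} {B : Matrix (Fin 2) (Fin 2) R}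
    (h : B * (stepMatrix x₁ * stepMatrix x₀) = s • (1 : Matrix (Fin 2) (Fin 2) R)) :
    (B * (stepMatrix (x₁ + t) * stepMatrix (x₀ - t))).trace = s * (2 + t ^ 2) := by
  have hB : B = s • (!![0, 1; -1, x₀] * !![0, 1; -1, x₁]) := by
    have h₁ : (stepMatrix x₁ * stepMatrix x₀) * (!![0, 1; -1, x₀] * !![0, 1; -1, x₁]) = 1 := by
      ext i j
      fin_cases i <;> fin_cases j <;>
        (simp [stepMatrix, Matrix.mul_apply, Fin.sum_univ_two]; try ring)
    calc B = B * ((stepMatrix x₁ * stepMatrix x₀) * (!![0, 1; -1, x₀] * !![0, 1; -1, x₁])) := by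
          rw [h₁, Matrix.mul_one]
      _ = _ := by rw [← Matrix.mul_assoc, h, Matrix.smul_mul, Matrix.one_mul]
  rw [hB]
  simp [stepMatrix, Matrix.trace_fin_two]
  ring

end TransferMatrix

/-- Cayley–Hamilton turns the powers into a Chebyshev recurrence; the factor `sin θ` avoids a
division. -/
theorem Matrix.sin_smul_pow {M : Matrix (Fin 2) (Fin 2) ℝ} (hdet : M.det = 1) {θ : ℝ}
    (htr : M.trace = 2 * Real.cos θ) (n : ℕ) :
    Real.sin θ • M ^ n = Real.sin (n * θ) • M - Real.sin (n * θ - θ) • 1 := by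
  induction n with
  | zero => simp
  | succ n ih =>
    have hM : M * M = (2 * Real.cos θ) • M - 1 := by
      rw [← htr]
      rw [Matrix.det_fin_two] at hdet
      ext i j
      fin_cases i <;> fin_cases j <;>
        simp [Matrix.mul_apply, Fin.sum_univ_two, Matrix.trace_fin_two] <;> linarith
    have h₁ : ((n + 1 : ℕ) : ℝ) * θ = n * θ + θ := by push_cast; ring
    rw [pow_succ, ← Matrix.smul_mul, ih, Matrix.sub_mul, Matrix.smul_mul, hM, h₁,
      add_sub_cancel_right, Real.sin_add, Real.sin_sub, smul_sub, smul_smul, Matrix.smul_mul,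
      Matrix.one_mul]
    module

/-- An elliptic matrix is conjugate to a rotation by `θ`. The condition `sin θ ≠ 0` keeps away from
trace `±2`, where Jordan blocks may occur. -/
theorem Matrix.pow_eq_cos_smul_one {M : Matrix (Fin 2) (Fin 2) ℝ} (hdet : M.det = 1) {θ : ℝ}
    (htr : M.trace = 2 * Real.cos θ) (hθ : Real.sin θ ≠ 0) {q : ℕ} (hq : Real.sin (q * θ) = 0) :
    M ^ q = Real.cos (q * θ) • (1 : Matrix (Fin 2) (Fin 2) ℝ) := by
  have h := Matrix.sin_smul_pow hdet htr q
  rw [Real.sin_sub, hq, zero_smul, zero_mul, zero_sub, zero_sub, neg_smul, neg_neg,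
    mul_comm, mul_smul] at h
  exact smul_right_injective _ hθ h

/-! ### Basic properties of the discrete Schrödinger operators -/

theorem shiftOp_apply (k : ℤ) (ψ : EllTwoZ) (n : ℤ) : shiftOp k ψ n = ψ (n + k) := rfl

theorem mulOp_apply (V : ℤ →ᵇ ℝ) (ψ : EllTwoZ) (n : ℤ) : mulOp V ψ n = V n * ψ n := rfl

theorem norm_shiftOp_le (k : ℤ) : ‖shiftOp k‖ ≤ 1 :=
  LinearMap.mkContinuous_norm_le _ zero_le_one _

theorem norm_mulOp_le (V : ℤ →ᵇ ℝ) : ‖mulOp V‖ ≤ ‖V‖ :=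
  LinearMap.mkContinuous_norm_le _ (norm_nonneg _) _

theorem shiftOp_mul_neg (k : ℤ) : shiftOp k * shiftOp (-k) = 1 := by
  ext ψ n
  simp [shiftOp_apply]

/-- The shift as a unit of the algebra of bounded operators. -/
noncomputable def shiftUnit (k : ℤ) : (EllTwoZ →L[ℂ] EllTwoZ)ˣ where
  val := shiftOp k
  inv := shiftOp (-k)
  val_inv := shiftOp_mul_neg k
  inv_val := by simpa using shiftOp_mul_neg (-k)

theorem norm_shiftOp_apply (k : ℤ) (ψ : EllTwoZ) : ‖shiftOp k ψ‖ = ‖ψ‖ := by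
  refine (sq_eq_sq₀ (norm_nonneg _) (norm_nonneg _)).1 ?_
  rw [ellTwoZ_norm_sq, ellTwoZ_norm_sq]
  exact (Equiv.addRight k).tsum_eq fun n => ‖ψ n‖ ^ (2 : ℕ)

theorem norm_schrodingerOp_sub_le (V W : ℤ →ᵇ ℝ) :
    ‖schrodingerOp V - schrodingerOp W‖ ≤ ‖V - W‖ := by
  have h : schrodingerOp V - schrodingerOp W = mulOp (V - W) := by
    ext ψ n
    change (ψ (n + 1) + ψ (n - 1) + V n * ψ n) - (ψ (n + 1) + ψ (n - 1) + W n * ψ n) =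
      ((V n - W n : ℝ) : ℂ) * ψ n
    push_cast
    ring
  rw [h]
  exact norm_mulOp_le _

theorem continuous_schrodingerOp : Continuous schrodingerOp := by
  refine (LipschitzWith.of_dist_le_mul (K := 1) fun V W => ?_).continuous
  rw [dist_eq_norm, dist_eq_norm, NNReal.coe_one, one_mul]
  exact norm_schrodingerOp_sub_le V W

theorem isSelfAdjoint_schrodingerOp (V : ℤ →ᵇ ℝ) : IsSelfAdjoint (schrodingerOp V) := by
  have hs (k : ℤ) : star (shiftOp k) = shiftOp (-k) := by
    rw [ContinuousLinearMap.star_eq_adjoint]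
    symm
    rw [ContinuousLinearMap.eq_adjoint_iff]
    intro ψ φ
    rw [lp.inner_eq_tsum, lp.inner_eq_tsum, ← (Equiv.addRight k).tsum_eq]
    simp [shiftOp_apply]
  have hm : star (mulOp V) = mulOp V := by
    rw [ContinuousLinearMap.star_eq_adjoint]
    symm
    rw [ContinuousLinearMap.eq_adjoint_iff]
    intro ψ φ
    rw [lp.inner_eq_tsum, lp.inner_eq_tsum]
    congr 1
    ext n
    simp [mulOp_apply]
    ring
  rw [IsSelfAdjoint, schrodingerOp, star_add, star_add, hs, hs, hm, neg_neg, add_comm (shiftOp (-1))]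

/-- Translating the potential conjugates the operator by a shift. -/
theorem schrodingerOp_eq_conj {V W : ℤ →ᵇ ℝ} {k : ℤ} (h : ∀ n, W n = V (n + k)) :
    schrodingerOp W = shiftUnit k * schrodingerOp V * ↑(shiftUnit k)⁻¹ := by
  rw [Units.eq_mul_inv_iff_mul_eq]
  ext ψ n
  change ψ (n + 1 + k) + ψ (n - 1 + k) + W n * ψ (n + k) =
    ψ (n + k + 1) + ψ (n + k - 1) + V (n + k) * ψ (n + k)
  rw [h, add_right_comm, sub_add_eq_add_sub]

instance : Nontrivial EllTwoZ := by
  refine ⟨lp.single 2 0 1, 0, fun h => ?_⟩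
  have := congrArg (fun ψ : EllTwoZ => ψ 0) h
  simp at this

/-! ### The discriminant of a periodic potential -/

open Polynomial

/-- The trace of the monodromy matrix of a `p`-periodic potential, as a polynomial in the energy. -/
noncomputable def discriminant (V : ℤ → ℝ) (p : ℕ) : ℂ[X] :=
  (transferMatrix (fun n => X - C (V n : ℂ)) p 0).trace

theorem eval_discriminant (V : ℤ → ℝ) (p : ℕ) (E : ℝ) :
    (discriminant V p).eval (E : ℂ) =
      ((transferMatrix (fun n => E - V n) p 0).trace : ℝ) := by
  have h₁ := map_transferMatrix (Polynomial.evalRingHom (E : ℂ)) (fun n => X - C (V n : ℂ)) p 0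
  have h₂ := map_transferMatrix Complex.ofRealHom (fun n => E - V n) p 0
  simp only [Polynomial.coe_evalRingHom, eval_sub, eval_X, eval_C] at h₁
  simp only [Complex.ofRealHom_eq_coe, Complex.ofReal_sub] at h₂
  rw [← h₂] at h₁
  have h₃ := congrArg Matrix.trace h₁
  simpa [Matrix.trace_fin_two, discriminant] using h₃

/-- Let `X` act on the dual space by the transpose of the operator. The coordinate functionals then
solve the three-term recurrence with coefficients `X - V n`, and `add_period_add_sub_period` yields
the identity. -/
theorem discriminant_apply {V : ℤ →ᵇ ℝ} {p : ℕ} (hV : ∀ n : ℤ, V (n + p) = V n) :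
    aeval (schrodingerOp V) (discriminant V p) = shiftOp p + shiftOp (-p) := by
  set H := schrodingerOp V
  let T : Module.Dual ℂ EllTwoZ →ₗ[ℂ] Module.Dual ℂ EllTwoZ := Module.Dual.transpose H.toLinearMap
  let c (n : ℤ) : Module.Dual ℂ EllTwoZ :=
    { toFun := fun ψ => ψ n, map_add' := fun _ _ => rfl, map_smul' := fun _ _ => rfl }
  have hT (P : ℂ[X]) (φ : Module.Dual ℂ EllTwoZ) (ψ : EllTwoZ) :
      aeval T P φ ψ = φ (aeval H P ψ) := by
    induction P using Polynomial.induction_on generalizing φ ψ with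
    | C a => simp [Algebra.algebraMap_eq_smul_one]
    | add P Q hP hQ => simp [hP, hQ]
    | monomial n a h =>
      have h₁ : aeval H (C a * X ^ n * X) = H * aeval H (C a * X ^ n) := by
        rw [mul_comm, map_mul, aeval_X]
      rw [pow_succ, ← mul_assoc, h₁, map_mul, aeval_X]
      exact h (T φ) ψ
  have he (n : ℤ) : Module.AEval'.of T (c (n + 1)) =
      (X - C (V n : ℂ)) • Module.AEval'.of T (c n) - Module.AEval'.of T (c (n - 1)) := by
    rw [sub_smul, Module.AEval'.X_smul_of, Module.AEval.C_smul, ← map_smul, ← map_sub, ← map_sub]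
    congr 1
    ext ψ
    change ψ (n + 1) = (ψ (n + 1) + ψ (n - 1) + V n * ψ n) - V n * ψ n - ψ (n - 1)
    ring
  ext ψ n
  have key := add_period_add_sub_period (p := p) (e := fun n => Module.AEval'.of T (c n))
    (fun i => by rw [hV]) he n
  rw [← discriminant, ← map_add, Module.AEval'.of, ← Module.AEval.of_aeval_smul] at key
  have h₁ := congrArg (fun φ : Module.Dual ℂ EllTwoZ => φ ψ)
    ((Module.AEval.of ℂ (Module.Dual ℂ EllTwoZ) T).injective key)
  exact ((h₁.trans (hT _ _ _)).symm)

/-- Floquet theory: energies in the spectrum have discriminant in `[-2, 2]`. -/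
theorem abs_trace_le_two_of_mem_spectrum {V : ℤ →ᵇ ℝ} {p : ℕ} (hV : ∀ n : ℤ, V (n + p) = V n)
    {E : ℝ} (hE : (E : ℂ) ∈ spectrum ℂ (schrodingerOp V)) :
    |(transferMatrix (fun n => E - V n) p 0).trace| ≤ 2 := by
  -- By spectral mapping the discriminant at `E` lies in the spectrum of a sum of two shifts, whose
  -- norm is at most 2.
  have h₁ := spectrum.subset_polynomial_aeval (schrodingerOp V) (discriminant V p)
    ⟨_, hE, rfl⟩
  rw [discriminant_apply hV] at h₁
  have h₂ := spectrum.norm_le_norm_of_mem h₁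
  simp only [eval_discriminant, Complex.norm_real, Real.norm_eq_abs] at h₂
  refine h₂.trans ((norm_add_le _ _).trans ?_)
  linarith [norm_shiftOp_le p, norm_shiftOp_le (-p)]

/-- Applied to the unit vector at 0 and read at site `p`, a constant discriminant would give `0 =
1`. -/
theorem discriminant_ne_C {V : ℤ →ᵇ ℝ} {p : ℕ} (hp : p ≠ 0) (hV : ∀ n : ℤ, V (n + p) = V n)
    (c : ℂ) : discriminant V p ≠ C c := by
  intro h
  have h₁ := discriminant_apply hV
  rw [h, aeval_C, Algebra.algebraMap_eq_smul_one] at h₁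
  have h₂ := congrArg (fun A : EllTwoZ →L[ℂ] EllTwoZ => A (lp.single 2 (0 : ℤ) (1 : ℂ)) p) h₁
  change c * (lp.single 2 (0 : ℤ) (1 : ℂ) : EllTwoZ) (p : ℤ) =
    (lp.single 2 (0 : ℤ) (1 : ℂ) : EllTwoZ) ((p : ℤ) + p) +
    (lp.single 2 (0 : ℤ) (1 : ℂ) : EllTwoZ) ((p : ℤ) + -p) at h₂
  have hp' : (p : ℤ) ≠ 0 := by exact_mod_cast hp
  have hp'' : (p : ℤ) + p ≠ 0 := by omega
  rw [lp.single_apply, lp.single_apply, lp.single_apply, Pi.single_eq_of_ne hp',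
    Pi.single_eq_of_ne hp'', add_neg_cancel, Pi.single_eq_same] at h₂
  simp at h₂

theorem exists_trace_ne {V : ℤ →ᵇ ℝ} {p : ℕ} (hp : p ≠ 0) (hV : ∀ n : ℤ, V (n + p) = V n)
    {a b : ℝ} (hab : a < b) : ∃ E₁ ∈ Set.Ioo a b, ∃ E₂ ∈ Set.Ioo a b,
      (transferMatrix (fun n => E₁ - V n) p 0).trace ≠
        (transferMatrix (fun n => E₂ - V n) p 0).trace := by
  by_contra! h
  obtain ⟨E₀, hE₀⟩ := Set.nonempty_Ioo.2 hab
  refine discriminant_ne_C hp hV ((discriminant V p).eval (E₀ : ℂ))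
    (eq_of_infinite_eval_eq _ _ (((Set.Ioo_infinite hab).image
      Complex.ofReal_injective.injOn).mono ?_))
  rintro _ ⟨E, hE, rfl⟩
  simp only [Set.mem_ofPred_eq, eval_C, eval_discriminant]
  rw [h E hE E₀ hE₀]

theorem continuous_trace (V : ℤ → ℝ) (p : ℕ) :
    Continuous fun E : ℝ => (transferMatrix (fun n => E - V n) p 0).trace := by
  have h : (fun E : ℝ => (transferMatrix (fun n => E - V n) p 0).trace) =
      fun E : ℝ => ((discriminant V p).eval (E : ℂ)).re := by
    ext E
    rw [eval_discriminant, Complex.ofReal_re]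
  rw [h]
  fun_prop

/-- If the spectrum of a `p`-periodic operator fills an interval, then for all large `q` some energy
in the interval has scalar monodromy over the period `q * p`. -/
theorem exists_monodromy_eq_smul_one {V : ℤ →ᵇ ℝ} {p : ℕ} (hp : p ≠ 0)
    (hV : ∀ n : ℤ, V (n + p) = V n) {a b : ℝ} (hab : a < b)
    (hs : ∀ E ∈ Set.Ioo a b, (E : ℂ) ∈ spectrum ℂ (schrodingerOp V)) :
    ∃ q₀ : ℕ, ∀ q : ℕ, q₀ ≤ q → ∃ E ∈ Set.Ioo a b, ∃ s : ℝ, |s| = 1 ∧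
      transferMatrix (fun n => E - V n) (q * p) 0 = s • (1 : Matrix (Fin 2) (Fin 2) ℝ) := by
  obtain ⟨E₁, hE₁, E₂, hE₂, hne⟩ := exists_trace_ne hp hV hab
  have hbd (E : ℝ) (hE : E ∈ Set.Ioo a b) := abs_le.1 (abs_trace_le_two_of_mem_spectrum hV (hs E hE))
  let t : ℝ → ℝ := fun E => (transferMatrix (fun n => E - V n) p 0).trace
  let θ : ℝ → ℝ := fun E => Real.arccos (t E / 2)
  have hθc : Continuous θ := Real.continuous_arccos.comp ((continuous_trace V p).div_const 2)
  have hcos (E : ℝ) (hE : E ∈ Set.Ioo a b) : t E = 2 * Real.cos (θ E) := by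
    have := hbd E hE
    rw [Real.cos_arccos (by simp only [t]; linarith) (by simp only [t]; linarith)]
    ring
  have hθne : θ E₁ ≠ θ E₂ := fun h => hne (by
    have := hcos E₁ hE₁
    rw [h, ← hcos E₂ hE₂] at this
    exact this)
  have hθ0 (E : ℝ) : 0 ≤ θ E := Real.arccos_nonneg _
  have hθπ (E : ℝ) : θ E ≤ Real.pi := Real.arccos_le_pi _
  clear_value θ
  wlog hlt : θ E₁ < θ E₂ generalizing E₁ E₂
  · exact this E₂ hE₂ E₁ hE₁ hne.symm hθne.symm (lt_of_le_of_ne (not_lt.1 hlt) hθne.symm)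
  have hπ := Real.pi_pos
  have hd : 0 < θ E₂ - θ E₁ := sub_pos.2 hlt
  -- For such `q` the angle `q * θ` sweeps an interval longer than `π`, so its interior contains a
  -- multiple of `π`.
  obtain ⟨q₀, hq₀⟩ := exists_nat_gt (Real.pi / (θ E₂ - θ E₁))
  refine ⟨q₀, fun q hq => ?_⟩
  have hq₁ : Real.pi / (θ E₂ - θ E₁) < q := hq₀.trans_le (by exact_mod_cast hq)
  have hqpos : (0 : ℝ) < q := (div_pos hπ hd).trans hq₁
  have hq₂ : Real.pi < q * (θ E₂ - θ E₁) := (div_lt_iff₀ hd).1 hq₁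
  let k : ℤ := ⌊q * θ E₁ / Real.pi⌋ + 1
  have hk₁ : q * θ E₁ < k * Real.pi := by
    rw [← div_lt_iff₀ hπ]
    simp [k]
  have hk₂ : k * Real.pi ≤ q * θ E₁ + Real.pi := by
    have := Int.floor_le (q * θ E₁ / Real.pi)
    rw [le_div_iff₀ hπ] at this
    simp only [k, Int.cast_add, Int.cast_one]
    linarith
  have hmem : k * Real.pi / q ∈ Set.uIcc (θ E₁) (θ E₂) := by
    rw [Set.uIcc_of_le hlt.le]
    exact ⟨(le_div_iff₀ hqpos).2 (by linarith), (div_le_iff₀ hqpos).2 (by linarith)⟩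
  obtain ⟨E, hE, hEk⟩ := intermediate_value_uIcc hθc.continuousOn hmem
  have hE' : E ∈ Set.Ioo a b := Set.OrdConnected.uIcc_subset inferInstance hE₁ hE₂ hE
  have hqE : q * θ E = k * Real.pi := by rw [hEk]; field_simp
  have hsin : Real.sin (q * θ E) = 0 := by rw [hqE, Real.sin_int_mul_pi]
  -- Strictness on both sides puts `θ E` inside `(0, π)`, hence `sin (θ E) ≠ 0`.
  have h₁ : θ E₁ < θ E := by rw [hEk, lt_div_iff₀ hqpos]; linarith
  have h₂ : θ E < θ E₂ := by rw [hEk, div_lt_iff₀ hqpos]; linarith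
  refine ⟨E, hE', Real.cos (q * θ E), ?_, ?_⟩
  · rw [hqE, Real.abs_cos_int_mul_pi]
  · rw [transferMatrix_mul_period (fun i => by rw [hV])]
    exact Matrix.pow_eq_cos_smul_one (det_transferMatrix _ _ _) (hcos E hE')
      (Real.sin_pos_of_pos_of_lt_pi ((hθ0 _).trans_lt h₁) (h₂.trans_le (hθπ _))).ne' hsin

/-- Changing a potential with scalar monodromy by `t` and `-t` at two adjacent sites of each period
opens a gap. -/
theorem not_mem_spectrum_of_perturbation {V W : ℤ →ᵇ ℝ} {m : ℕ} {E s t : ℝ} (hs : |s| = 1)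
    (ht : t ≠ 0) (hW : ∀ n : ℤ, W (n + (m + 2 : ℕ)) = W n)
    (hM : transferMatrix (fun n => E - V n) (m + 2) 0 = s • (1 : Matrix (Fin 2) (Fin 2) ℝ))
    (h₀ : W 0 = V 0 + t) (h₁ : W 1 = V 1 - t)
    (h : ∀ n : ℤ, 2 ≤ n → n < (m + 2 : ℕ) → W n = V n) :
    (E : ℂ) ∉ spectrum ℂ (schrodingerOp W) := by
  intro hE
  have h₂ := abs_trace_le_two_of_mem_spectrum hW hE
  have h₃ (x : ℤ → ℝ) : transferMatrix x 2 0 = stepMatrix (x 1) * stepMatrix (x 0) := by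
    simp [transferMatrix]
  rw [transferMatrix_add, h₃, ← transferMatrix_congr (x := fun n => E - V n), h₀, h₁,
    sub_add_eq_sub_sub, ← sub_add, trace_perturbed_monodromy, abs_mul, hs, one_mul,
    abs_of_nonneg (by positivity)] at h₂
  · have := pow_pos (abs_pos.2 ht) 2
    rw [sq_abs] at this
    linarith
  · rw [← hM, transferMatrix_add, h₃]
  · intro i hi
    rw [h _ (by push_cast; omega) (by push_cast; omega)]

/-! ### Isolated points of the spectrum -/

open Filter Topology

/-- At an isolated point `c` of its spectrum, `a - c` has a commuting generalized inverse. -/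
theorem exists_generalized_inverse_of_not_accPt (H : EllTwoZ →L[ℂ] EllTwoZ) [hH : IsStarNormal H]
    {c : ℂ} (hc : ¬ AccPt c (𝓟 (spectrum ℂ H))) :
    ∃ R : EllTwoZ →L[ℂ] EllTwoZ,
      R * (H - algebraMap ℂ _ c) = (H - algebraMap ℂ _ c) * R ∧
      (H - algebraMap ℂ _ c) * R * (H - algebraMap ℂ _ c) = H - algebraMap ℂ _ c := by
  -- Since `c` is isolated, continuity there is automatic; the convention `0⁻¹ = 0` supplies the
  -- value at `c`.
  have hcont : ContinuousOn (fun z : ℂ => (z - c)⁻¹) (spectrum ℂ H) := by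
    intro z hz
    by_cases hzc : z = c
    · subst hzc
      rw [accPt_iff_nhds] at hc
      push Not at hc
      obtain ⟨U, hU, hU'⟩ := hc
      refine ContinuousWithinAt.congr_of_eventuallyEq
        (continuousWithinAt_const (b := (0 : ℂ))) ?_ (by simp)
      filter_upwards [mem_nhdsWithin_of_mem_nhds hU, self_mem_nhdsWithin] with y hy hy'
      rw [hU' y ⟨hy, hy'⟩, sub_self, inv_zero]
    · exact ((continuousAt_id.sub continuousAt_const).inv₀
        (sub_ne_zero.2 hzc)).continuousWithinAt
  have hsub : ContinuousOn (fun z : ℂ => z - c) (spectrum ℂ H) := by fun_prop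
  have hD : H - algebraMap ℂ _ c = cfc (fun z : ℂ => z - c) H := by
    rw [cfc_sub (fun z : ℂ => z) (fun _ => c) H, cfc_id' ℂ H, cfc_const c H]
  refine ⟨cfc (fun z : ℂ => (z - c)⁻¹) H, ?_, ?_⟩
  · rw [hD, ← cfc_mul _ _ H hcont hsub, ← cfc_mul _ _ H hsub hcont]
    simp only [mul_comm]
  · rw [hD, ← cfc_mul _ _ H hsub hcont, 
      ← cfc_mul (fun z : ℂ => (z - c) * (z - c)⁻¹) (fun z : ℂ => z - c) H (hsub.mul hcont) hsub]
    congr 1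
    ext z
    exact mul_inv_mul_cancel _

theorem eq_zero_of_schrodingerOp_apply_eq {V : ℤ →ᵇ ℝ} {c : ℂ} {ψ : EllTwoZ}
    (hψ : (schrodingerOp V - algebraMap ℂ (EllTwoZ →L[ℂ] EllTwoZ) c) ψ = 0)
    (h₀ : ψ 0 = 0) (h₁ : ψ 1 = 0) : ψ = 0 := by
  have hrec (n : ℤ) : ψ (n + 1) + ψ (n - 1) + V n * ψ n - c * ψ n = 0 :=
    congrArg (fun φ : EllTwoZ => φ n) hψ
  have key (n : ℤ) : ψ n = 0 ∧ ψ (n + 1) = 0 := by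
    induction n with
    | zero => exact ⟨h₀, h₁⟩
    | succ n ih =>
      have := hrec (n + 1)
      rw [add_sub_cancel_right, ih.1, ih.2] at this
      exact ⟨ih.2, by simpa using this⟩
    | pred n ih =>
      have := hrec (-n)
      rw [ih.1, ih.2] at this
      exact ⟨by simpa using this, by rw [sub_add_cancel]; exact ih.1⟩
  ext n
  exact (key n).1

/-- The values at 0 and 1 embed the kernel in `ℂ × ℂ`, and a linear injection from a
finite-dimensional space is bounded below. -/
theorem exists_norm_le_of_schrodingerOp_apply_eq (V : ℤ →ᵇ ℝ) (c : ℂ) :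
    ∃ K : ℝ, 0 < K ∧ ∀ φ : EllTwoZ,
      (schrodingerOp V - algebraMap ℂ (EllTwoZ →L[ℂ] EllTwoZ) c) φ = 0 →
      ‖φ‖ ≤ K * max ‖φ 0‖ ‖φ 1‖ := by
  let D := schrodingerOp V - algebraMap ℂ (EllTwoZ →L[ℂ] EllTwoZ) c
  let L : D.ker →ₗ[ℂ] ℂ × ℂ :=
    { toFun := fun φ => ((φ : EllTwoZ) 0, (φ : EllTwoZ) 1)
      map_add' := fun _ _ => rfl
      map_smul' := fun _ _ => rfl }
  have hL : L.ker = ⊥ := by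
    rw [LinearMap.ker_eq_bot']
    rintro ⟨φ, hφ⟩ h
    exact Subtype.ext (eq_zero_of_schrodingerOp_apply_eq hφ (congrArg Prod.fst h)
      (congrArg Prod.snd h))
  have : FiniteDimensional ℂ D.ker := FiniteDimensional.of_injective L (LinearMap.ker_eq_bot.1 hL)
  obtain ⟨K, hK, hKL⟩ := L.exists_antilipschitzWith hL
  refine ⟨K, hK, fun φ hφ => ?_⟩
  have := hKL.le_mul_dist ⟨φ, hφ⟩ 0
  rwa [dist_zero_right, map_zero, dist_zero_right] at this

theorem tendsto_ellTwoZ_cofinite (ψ : EllTwoZ) : Tendsto (fun n => ‖ψ n‖) cofinite (𝓝 0) := by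
  have h := (ellTwoZ_summable ψ).tendsto_cofinite_zero.sqrt
  simpa using h

/-- The spectrum of a Schrödinger operator with uniformly recurrent potential has no isolated
points. -/
theorem accPt_spectrum_of_recurrent {V : ℤ →ᵇ ℝ}
    (hrec : ∀ ε > 0, {k : ℤ | ∀ n, |V n - V (n + k)| ≤ ε}.Infinite) {c : ℂ}
    (hc : c ∈ spectrum ℂ (schrodingerOp V)) : AccPt c (𝓟 (spectrum ℂ (schrodingerOp V))) := by
  by_contra hacc
  have : IsStarNormal (schrodingerOp V) := (isSelfAdjoint_schrodingerOp V).isStarNormal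
  obtain ⟨R, hcomm, hgen⟩ := exists_generalized_inverse_of_not_accPt _ hacc
  obtain ⟨K, hK, hKker⟩ := exists_norm_le_of_schrodingerOp_apply_eq V c
  set H := schrodingerOp V
  set D := H - algebraMap ℂ (EllTwoZ →L[ℂ] EllTwoZ) c with hD
  have hDP (φ : EllTwoZ) : D (φ - R (D φ)) = 0 := by
    have := congrArg (fun A : EllTwoZ →L[ℂ] EllTwoZ => A φ) hgen
    rw [map_sub, sub_eq_zero]
    exact this.symm
  -- `1 - R * D` maps into the kernel of `D`; if it vanished, `D` would be invertible.
  obtain ⟨φ, hφ⟩ : ∃ φ, φ - R (D φ) ≠ 0 := by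
    by_contra! h
    have h₁ : R * D = 1 := by
      ext1 φ
      exact (sub_eq_zero.1 (h φ)).symm
    refine hc ?_
    rw [spectrum.mem_resolventSet_iff, ← neg_sub, IsUnit.neg_iff]
    exact ⟨⟨D, R, hcomm ▸ h₁, h₁⟩, rfl⟩
  set ψ := φ - R (D φ)
  have hψ : D ψ = 0 := hDP φ
  have hψpos : 0 < ‖ψ‖ := norm_pos_iff.2 hφ
  clear_value ψ
  -- With these choices of `ε` and `η`, each contributes at most `‖ψ‖ / 4` to the final bound on
  -- `‖ψ‖`.
  set ε := 1 / (4 * ((1 + K) * ‖R‖ + 1)) with hε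
  have hden : 0 < (1 + K) * ‖R‖ + 1 := by positivity
  have hεpos : 0 < ε := by positivity
  set η := ‖ψ‖ / (4 * K) with hη
  have hηpos : 0 < η := by positivity
  have h₁ : ∀ᶠ k : ℤ in cofinite, ‖ψ k‖ < η :=
    (tendsto_ellTwoZ_cofinite ψ).eventually_lt_const hηpos
  have h₂ : ∀ᶠ k : ℤ in cofinite, ‖ψ (1 + k)‖ < η :=
    (Equiv.addLeft (1 : ℤ)).injective.tendsto_cofinite.eventually h₁
  -- An almost-period so far out that `ψ` is already small at `k` and `k + 1`.
  obtain ⟨k, hk, hk₁, hk₂⟩ :=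
    (((hrec ε hεpos).frequently_cofinite).and_eventually (h₁.and h₂)).exists
  let W : ℤ →ᵇ ℝ := V.compContinuous ⟨fun n => n + k, continuous_of_discreteTopology⟩
  have hVW : ‖H - schrodingerOp W‖ ≤ ε :=
    (norm_schrodingerOp_sub_le V W).trans
      ((BoundedContinuousFunction.norm_le hεpos.le).2 fun n => hk n)
  set χ := shiftOp k ψ with hχ
  have hχn : ‖χ‖ = ‖ψ‖ := norm_shiftOp_apply k ψ
  have hWχ : schrodingerOp W χ = c • χ := by
    have hconj := (Units.eq_mul_inv_iff_mul_eq _).1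
      (schrodingerOp_eq_conj (V := V) (W := W) (k := k) fun _ => rfl)
    have h₃ : schrodingerOp W (shiftOp k ψ) = shiftOp k (H ψ) :=
      congrArg (fun A : EllTwoZ →L[ℂ] EllTwoZ => A ψ) hconj
    have h₄ : H ψ = c • ψ := sub_eq_zero.1 hψ
    rw [hχ, h₃, h₄, map_smul]
  have hDχ : ‖D χ‖ ≤ ε * ‖ψ‖ := by
    have h₃ : D χ = (H - schrodingerOp W) χ := by
      change H χ - c • χ = H χ - schrodingerOp W χ
      rw [hWχ]
    rw [h₃, ← hχn]
    exact (ContinuousLinearMap.le_opNorm _ _).trans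
      (mul_le_mul_of_nonneg_right hVW (norm_nonneg _))
  set δ := ‖R‖ * (ε * ‖ψ‖) with hδ
  have hRD : ‖R (D χ)‖ ≤ δ := (R.le_opNorm _).trans (mul_le_mul_of_nonneg_left hDχ (norm_nonneg _))
  have hcoord (n : ℤ) (hn : ‖ψ (n + k)‖ < η) : ‖(χ - R (D χ) : EllTwoZ) n‖ ≤ η + δ := by
    have h₃ : (χ - R (D χ) : EllTwoZ) n = ψ (n + k) - R (D χ) n := rfl
    rw [h₃]
    exact (norm_sub_le _ _).trans (add_le_add hn.le
      ((lp.norm_apply_le_norm (by norm_num) _ _).trans hRD))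
  have h₅ : ‖χ - R (D χ)‖ ≤ K * (η + δ) :=
    (hKker _ (hDP χ)).trans (by
      gcongr
      exact max_le (hcoord 0 (by simpa using hk₁)) (hcoord 1 hk₂))
  have h₆ : ‖ψ‖ ≤ K * (η + δ) + δ := by
    rw [← hχn]
    calc ‖χ‖ = ‖(χ - R (D χ)) + R (D χ)‖ := by rw [sub_add_cancel]
      _ ≤ _ := (norm_add_le _ _).trans (add_le_add h₅ hRD)
  have h₇ : K * η = ‖ψ‖ / 4 := by rw [hη]; field_simp
  have h₈ : (1 + K) * ‖R‖ * ε ≤ 1 / 4 := by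
    rw [hε, mul_one_div, div_le_div_iff₀ (by positivity) (by norm_num)]
    linarith
  have h₉ : K * (η + δ) + δ = K * η + ((1 + K) * ‖R‖ * ε) * ‖ψ‖ := by rw [hδ]; ring
  have := mul_le_mul_of_nonneg_right h₈ hψpos.le
  linarith

/-! ### Potentials sampled along minimal translations -/

open Filter Topology

theorem IsProcyclic.t2Space {G : Type u} [Group G] [TopologicalSpace G] (h : IsProcyclic G) :
    T2Space G := by
  obtain ⟨I, _, _, _, S, ⟨e⟩⟩ := h
  exact e.toHomeomorph.isEmbedding.t2Space

theorem IsProcyclic.totallyDisconnectedSpace {G : Type u} [Group G] [TopologicalSpace G]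
    (h : IsProcyclic G) : TotallyDisconnectedSpace G := by
  obtain ⟨I, _, _, _, S, ⟨e⟩⟩ := h
  exact e.symm.toHomeomorph.totallyDisconnectedSpace

theorem zpow_apply_of_translation {G : Type*} [Group G] {T : Equiv.Perm G} {g : G}
    (hg : ∀ x, T x = x * g) (n : ℤ) (x : G) : (T ^ n) x = x * g ^ n := by
  have h : T = Equiv.mulRight g := by ext x; exact hg x
  rw [h]
  rw [Equiv.zpow_mulRight]
  rfl

theorem norm_sampledPotential_sub_le {Ω : Type u} [TopologicalSpace Ω] [CompactSpace Ω]
    (T : Equiv.Perm Ω) (f g : C(Ω, ℝ)) (ω : Ω) :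
    ‖sampledPotential T f ω - sampledPotential T g ω‖ ≤ ‖f - g‖ :=
  (BoundedContinuousFunction.norm_le (norm_nonneg _)).2 fun n =>
    (f - g).norm_coe_le_norm ((T ^ n) ω)

theorem continuous_sampledPotential {Ω : Type u} [TopologicalSpace Ω] [CompactSpace Ω]
    (T : Equiv.Perm Ω) (ω : Ω) :
    Continuous fun f : C(Ω, ℝ) => sampledPotential T f ω := by
  refine (LipschitzWith.of_dist_le_mul (K := 1) fun f g => ?_).continuous
  rw [dist_eq_norm, dist_eq_norm, NNReal.coe_one, one_mul]
  exact norm_sampledPotential_sub_le T f g ω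

section Translation

variable {Ω : Type u} [Group Ω] [TopologicalSpace Ω] [IsTopologicalGroup Ω] [CompactSpace Ω]

/-- The translates of `f` depend continuously on the point in the uniform norm, by compactness;
sampling restricts them to the powers of `g`. -/
theorem continuous_sampledPotential_point {T : Equiv.Perm Ω} {g : Ω} (hg : ∀ x, T x = x * g)
    (f : C(Ω, ℝ)) : Continuous fun ω : Ω => sampledPotential T f ω := by
  let F : C(Ω, C(Ω, ℝ)) := (f.comp ⟨fun x : Ω × Ω => x.1 * x.2, continuous_mul⟩).curry
  rw [continuous_iff_continuousAt]
  intro ω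
  rw [ContinuousAt, tendsto_iff_dist_tendsto_zero]
  refine squeeze_zero (fun _ => dist_nonneg) (fun x => ?_)
    (tendsto_iff_dist_tendsto_zero.1 (F.continuous.tendsto ω))
  refine (BoundedContinuousFunction.dist_le dist_nonneg).2 fun n => ?_
  rw [sampledPotential_apply, sampledPotential_apply, zpow_apply_of_translation hg,
    zpow_apply_of_translation hg]
  exact ContinuousMap.dist_apply_le_dist (f := F x) (g := F ω) (g ^ n)

theorem isOpen_setOf_not_mem_spectrum (c : ℂ) :
    IsOpen {V : ℤ →ᵇ ℝ | c ∉ spectrum ℂ (schrodingerOp V)} := by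
  have h : {V : ℤ →ᵇ ℝ | c ∉ spectrum ℂ (schrodingerOp V)} =
      (fun V => algebraMap ℂ (EllTwoZ →L[ℂ] EllTwoZ) c - schrodingerOp V) ⁻¹' {a | IsUnit a} := by
    ext V
    exact spectrum.notMem_iff
  rw [h]
  exact Units.isOpen.preimage (continuous_const.sub continuous_schrodingerOp)

/-- The spectrum does not depend on the point of the orbit closure. -/
theorem spectrum_sampledPotential_eq {T : Equiv.Perm Ω} (hT : IsMinimalTranslation T)
    (f : C(Ω, ℝ)) (ω ω' : Ω) :
    spectrum ℂ (schrodingerOp (sampledPotential T f ω)) =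
      spectrum ℂ (schrodingerOp (sampledPotential T f ω')) := by
  obtain ⟨g, hg⟩ := hT.translation
  have key (x y : Ω) : spectrum ℂ (schrodingerOp (sampledPotential T f x)) ⊆
      spectrum ℂ (schrodingerOp (sampledPotential T f y)) := by
    intro c hc
    by_contra hcy
    have hopen := (isOpen_setOf_not_mem_spectrum c).preimage
      (continuous_sampledPotential_point hg f)
    obtain ⟨_, hz, k, rfl⟩ := (hT.minimal x).inter_open_nonempty _ hopen ⟨y, hcy⟩
    refine hz ?_
    rwa [schrodingerOp_eq_conj (V := sampledPotential T f x) (k := k), spectrum.units_conjugate]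
    intro n
    rw [sampledPotential_apply, sampledPotential_apply, zpow_add, Equiv.Perm.mul_apply]
  exact (key _ _).antisymm (key _ _)

theorem infinite_setOf_zpow_mem [T2Space Ω] [Infinite Ω] {T : Equiv.Perm Ω} {ω : Ω}
    (hω : Dense (Set.range fun n : ℤ => (T ^ n) ω)) {U : Set Ω} (hU : IsOpen U)
    (hne : U.Nonempty) : {n : ℤ | (T ^ n) ω ∈ U}.Infinite := by
  intro hfin
  -- An isolated point would make the group discrete, hence finite by compactness. Removing finitely
  -- many points therefore keeps the orbit dense.
  have hbot (x : Ω) : (𝓝[≠] x).NeBot := by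
    rw [neBot_iff]
    intro h
    have hx : IsOpen {x} := isOpen_singleton_iff_punctured_nhds x |>.2 h
    have h₁ : IsOpen ({1} : Set Ω) := by
      have := (Homeomorph.mulLeft x⁻¹).isOpenMap _ hx
      simpa using this
    have := discreteTopology_of_isOpen_singleton_one h₁
    have := finite_of_compact_of_discrete (X := Ω)
    exact not_finite Ω
  obtain ⟨_, hz, ⟨n, rfl⟩, hn⟩ :=
    (hω.sdiff_finite (hfin.image fun n : ℤ => (T ^ n) ω)).inter_open_nonempty U hU hne
  exact hn ⟨n, hz, rfl⟩

theorem sampledPotential_recurrent [T2Space Ω] [Infinite Ω] {T : Equiv.Perm Ω}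
    (hT : IsMinimalTranslation T) (f : C(Ω, ℝ)) (ω : Ω) {ε : ℝ} (hε : 0 < ε) :
    {k : ℤ | ∀ n, |sampledPotential T f ω n - sampledPotential T f ω (n + k)| ≤ ε}.Infinite := by
  obtain ⟨g, hg⟩ := hT.translation
  refine (infinite_setOf_zpow_mem (hT.minimal ω) ((Metric.isOpen_ball
    (x := sampledPotential T f ω) (ε := ε)).preimage (continuous_sampledPotential_point hg f))
    ⟨ω, Metric.mem_ball_self hε⟩).mono ?_
  intro k hk n
  have h := (BoundedContinuousFunction.dist_coe_le_dist n).trans (Metric.mem_ball'.1 hk).le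
  rwa [sampledPotential_apply T f ((T ^ k) ω), ← Equiv.Perm.mul_apply, ← zpow_add] at h

/-! ### Periodic approximation and opening of gaps -/

theorem exists_zpow_mem_iff_dvd (N : OpenNormalSubgroup Ω) (g : Ω) :
    ∃ p : ℕ, p ≠ 0 ∧ ∀ n : ℤ, g ^ n ∈ N ↔ (p : ℤ) ∣ n := by
  have : Finite (Ω ⧸ N.toSubgroup) := N.toSubgroup.quotient_finite_of_isOpen N.isOpen
  refine ⟨orderOf (g : Ω ⧸ N.toSubgroup), (orderOf_pos _).ne', fun n => ?_⟩
  rw [orderOf_dvd_iff_zpow_eq_one, ← QuotientGroup.mk_zpow, QuotientGroup.eq_one_iff]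
  rfl

theorem zpow_ne_one_of_isMinimalTranslation {Ω : Type u} [Group Ω] [TopologicalSpace Ω]
    [T2Space Ω] [Infinite Ω] {T : Equiv.Perm Ω}
    (hT : IsMinimalTranslation T) {g : Ω} (hg : ∀ x, T x = x * g) {k : ℕ} (hk : k ≠ 0) :
    g ^ k ≠ 1 := by
  intro h
  have hfin : (Set.range fun n : ℤ => (T ^ n) 1).Finite := by
    have h₁ : IsOfFinOrder g := isOfFinOrder_iff_pow_eq_one.2 ⟨k, Nat.pos_of_ne_zero hk, h⟩
    refine (finite_zpowers.2 h₁).subset ?_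
    rintro _ ⟨n, rfl⟩
    exact ⟨n, by simp [zpow_apply_of_translation hg]⟩
  have := (hT.minimal 1).closure_eq
  rw [hfin.isClosed.closure_eq] at this
  rw [this] at hfin
  exact Set.infinite_univ hfin

/-- Continuous functions on a profinite group are uniformly approximated by functions invariant
under an open normal subgroup. -/
theorem exists_invariant_norm_sub_le [TotallyDisconnectedSpace Ω] (f : C(Ω, ℝ)) {ε : ℝ}
    (hε : 0 < ε) : ∃ (N : OpenNormalSubgroup Ω) (f₁ : C(Ω, ℝ)), ‖f₁ - f‖ ≤ ε ∧
      ∀ x, ∀ n ∈ N, f₁ (x * n) = f₁ x := by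
  let F : C(Ω, C(Ω, ℝ)) :=
    (f.comp ⟨fun x : Ω × Ω => x.2 * x.1, continuous_snd.mul continuous_fst⟩).curry
  obtain ⟨N, hN⟩ := ProfiniteGrp.exist_openNormalSubgroup_sub_open_nhds_of_one
    (Metric.isOpen_ball.preimage F.continuous : IsOpen (F ⁻¹' Metric.ball (F 1) ε))
    (Metric.mem_ball_self hε)
  have : DiscreteTopology (Ω ⧸ N.toSubgroup) := QuotientGroup.discreteTopology N.isOpen
  -- `f` is evaluated at a chosen representative of each coset, which differs from the point by an
  -- element of `N`.
  let f₁ : C(Ω, ℝ) := ⟨fun x => f (Quotient.out (x : Ω ⧸ N.toSubgroup)),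
    (continuous_of_discreteTopology (f := fun c : Ω ⧸ N.toSubgroup => f c.out)).comp
      QuotientGroup.continuous_mk⟩
  refine ⟨N, f₁, (ContinuousMap.norm_le _ hε.le).2 fun x => ?_, fun x n hn => ?_⟩
  · obtain ⟨n, hn⟩ := QuotientGroup.mk_out_eq_mul N.toSubgroup x
    have h₁ := (ContinuousMap.dist_apply_le_dist (f := F n) (g := F 1) x).trans (hN n.2).le
    have h₂ : F 1 x = f x := congrArg f (mul_one x)
    have h₃ : F n x = f₁ x := congrArg f hn.symm
    rwa [h₂, h₃] at h₁
  · change f _ = f _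
    rw [QuotientGroup.mk_mul_of_mem x hn]

/-- Small perturbations produce energies outside the spectrum in any prescribed interval. -/
theorem exists_near_gap [T2Space Ω] [TotallyDisconnectedSpace Ω] [Infinite Ω] {T : Equiv.Perm Ω}
    (hT : IsMinimalTranslation T) (f : C(Ω, ℝ)) {ε : ℝ} (hε : 0 < ε) {a b : ℝ} (hab : a < b) :
    ∃ h : C(Ω, ℝ), ‖h - f‖ < ε ∧ ∃ E ∈ Set.Ioo a b,
      (E : ℂ) ∉ spectrum ℂ (schrodingerOp (sampledPotential T h 1)) := by
  obtain ⟨g, hg⟩ := hT.translation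
  have hV (h : C(Ω, ℝ)) (n : ℤ) : sampledPotential T h 1 n = h (g ^ n) := by
    rw [sampledPotential_apply, zpow_apply_of_translation hg, one_mul]
  -- The approximation costs `ε / 4` and the later perturbation at most `2 * (ε / 4)`, in total less
  -- than `ε`.
  obtain ⟨N₁, f₁, hf₁, hinv⟩ := exists_invariant_norm_sub_le f (ε := ε / 4) (by positivity)
  by_cases hs : ∀ E ∈ Set.Ioo a b, (E : ℂ) ∈ spectrum ℂ (schrodingerOp (sampledPotential T f₁ 1))
  swap
  · push Not at hs
    exact ⟨f₁, by linarith, hs⟩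
  obtain ⟨p₁, hp₁, hN₁⟩ := exists_zpow_mem_iff_dvd N₁ g
  have hper (n m : ℤ) (hm : (p₁ : ℤ) ∣ m) : f₁ (g ^ (n + m)) = f₁ (g ^ n) := by
    rw [zpow_add, hinv _ _ ((hN₁ m).2 hm)]
  obtain ⟨q₀, hq₀⟩ := exists_monodromy_eq_smul_one hp₁
    (fun n => by rw [hV, hV, hper n p₁ dvd_rfl]) hab hs
  -- Keeping `g, …, g ^ (k₀ - 1)` out of the smaller subgroup forces its period `p₂` to be at least
  -- `k₀`: long enough for `hq₀`, and with room for two sites.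
  let k₀ := max (q₀ * p₁) 2
  let S : Set Ω := (fun k : ℕ => g ^ k) '' Set.Ico 1 k₀
  have hS : IsClosed S := ((Set.finite_Ico 1 k₀).image _).isClosed
  obtain ⟨N₂, hN₂⟩ := ProfiniteGrp.exist_openNormalSubgroup_sub_open_nhds_of_one
    (N₁.isOpen.inter hS.isOpen_compl) ⟨N₁.one_mem, by
      rintro ⟨k, hk, h⟩
      exact zpow_ne_one_of_isMinimalTranslation hT hg (by have := hk.1; omega) h⟩
  obtain ⟨p₂, hp₂, hN₂'⟩ := exists_zpow_mem_iff_dvd N₂ g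
  have hmem : g ^ (p₂ : ℤ) ∈ N₂ := (hN₂' p₂).2 dvd_rfl
  have hk₀ : k₀ ≤ p₂ := by
    by_contra! hlt
    exact (hN₂ hmem).2 ⟨p₂, ⟨Nat.one_le_iff_ne_zero.2 hp₂, hlt⟩, (zpow_natCast g p₂).symm⟩
  have hdvd : (p₁ : ℤ) ∣ p₂ := (hN₁ p₂).1 (hN₂ hmem).1
  obtain ⟨q, hq⟩ : p₁ ∣ p₂ := by exact_mod_cast hdvd
  have hq' : q₀ ≤ q := by
    have h₁ : q₀ * p₁ ≤ q * p₁ := by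
      rw [mul_comm q, ← hq]
      exact (le_max_left _ _).trans hk₀
    exact Nat.le_of_mul_le_mul_right h₁ (Nat.pos_of_ne_zero hp₁)
  obtain ⟨m, hm⟩ : ∃ m, p₂ = m + 2 := ⟨p₂ - 2, by have := (le_max_right _ _).trans hk₀; omega⟩
  obtain ⟨E, hE, s, hs₁, hM⟩ := hq₀ q hq'
  rw [mul_comm q, ← hq, hm] at hM
  have hclopen : IsClopen (N₂ : Set Ω) := N₂.toOpenSubgroup.isClopen
  let χ : C(Ω, ℝ) := ⟨Set.indicator (N₂ : Set Ω) 1, continuous_one.indicator (by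
    rw [hclopen.frontier_eq]; simp)⟩
  have hχ (n : ℤ) : χ (g ^ n) = if (p₂ : ℤ) ∣ n then 1 else 0 := by
    change Set.indicator (N₂ : Set Ω) 1 (g ^ n) = _
    by_cases h : (p₂ : ℤ) ∣ n
    · rw [if_pos h, Set.indicator_of_mem ((hN₂' n).2 h), Pi.one_apply]
    · rw [if_neg h, Set.indicator_of_notMem (mt (hN₂' n).1 h)]
  have hχ₁ (x : Ω) : |χ x| ≤ 1 := by
    change |Set.indicator (N₂ : Set Ω) 1 x| ≤ 1
    by_cases h : x ∈ (N₂ : Set Ω) <;> simp [h]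
  -- Along the orbit of 1, `d` is `1` at multiples of `p₂`, `-1` one step later and `0` elsewhere.
  let d : C(Ω, ℝ) := χ - χ.comp ⟨fun x => x * g⁻¹, continuous_mul_const _⟩
  have hd : ‖d‖ ≤ 2 := (ContinuousMap.norm_le _ zero_le_two).2 fun x => by
    change |χ x - χ (x * g⁻¹)| ≤ 2
    refine (abs_sub _ _).trans ?_
    linarith [hχ₁ x, hχ₁ (x * g⁻¹)]
  have hW (n : ℤ) : sampledPotential T (f₁ + (ε / 4) • d) 1 n = f₁ (g ^ n) +
      ε / 4 * ((if (p₂ : ℤ) ∣ n then 1 else 0) - (if (p₂ : ℤ) ∣ n - 1 then 1 else 0)) := by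
    rw [hV, ← hχ, ← hχ, zpow_sub_one]
    rfl
  refine ⟨f₁ + (ε / 4) • d, ?_, E, hE, ?_⟩
  · have h₁ : f₁ + (ε / 4) • d - f = (f₁ - f) + (ε / 4) • d := by abel
    rw [h₁]
    refine (norm_add_le _ _).trans_lt ?_
    rw [norm_smul, Real.norm_of_nonneg (by positivity)]
    have := mul_le_mul_of_nonneg_left hd (by positivity : 0 ≤ ε / 4)
    linarith
  · have hnd (n : ℤ) (h₁ : 0 < n) (h₂ : n < p₂) : ¬ (p₂ : ℤ) ∣ n := fun h =>
      (Int.le_of_dvd h₁ h).not_gt h₂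
    refine not_mem_spectrum_of_perturbation hs₁ (t := ε / 4) (by positivity) ?_ hM ?_ ?_ ?_
    · intro n
      rw [hW, hW, ← hm, hper n p₂ hdvd, add_sub_right_comm]
      simp only [dvd_add_self_right]
    · rw [hW, hV, if_pos (dvd_zero _), if_neg]
      · ring
      · rw [zero_sub, dvd_neg]
        exact hnd 1 one_pos (by omega)
    · rw [hW, hV, if_neg (hnd 1 one_pos (by omega)), sub_self, if_pos (dvd_zero _)]
      ring
    · intro n h₁ h₂
      rw [hW, hV, if_neg (hnd n (by omega) (by omega)), if_neg (hnd _ (by omega) (by omega))]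
      ring

end Translation

/-! ### The Baire category argument -/

theorem AccPt.of_ofReal_image {K : Set ℝ} {x : ℝ}
    (h : AccPt (x : ℂ) (𝓟 ((fun y : ℝ => (y : ℂ)) '' K))) : AccPt x (𝓟 K) := by
  rw [accPt_iff_nhds] at h ⊢
  intro U hU
  rw [Complex.isometry_ofReal.isClosedEmbedding.isInducing.nhds_eq_comap] at hU
  obtain ⟨V, hV, hVU⟩ := hU
  obtain ⟨_, ⟨hy, y, hyK, rfl⟩, hne⟩ := h V hV
  exact ⟨y, ⟨hVU hy, hyK⟩, fun hyx => hne (by rw [hyx])⟩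

theorem theorem2p13 {Ω : Type u} [Group Ω] [TopologicalSpace Ω] [IsTopologicalGroup Ω]
    [CompactSpace Ω] [Infinite Ω] (hΩ : IsProcyclic Ω)
    (T : Equiv.Perm Ω) (hT : IsMinimalTranslation T) :
    ∃ 𝒞 : Set C(Ω, ℝ), Dense 𝒞 ∧ IsGδ 𝒞 ∧
      ∀ f ∈ 𝒞, ∀ ω : Ω, ∃ K : Set ℝ, IsCantorSet K ∧
        spectrum ℂ (schrodingerOp (sampledPotential T f ω)) = (fun x : ℝ => (x : ℂ)) '' K := by
  have := hΩ.t2Space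
  have := hΩ.totallyDisconnectedSpace
  -- The base point 1 suffices, because the spectrum does not depend on `ω`; countably many rational
  -- intervals detect any interior.
  let U (r : {r : ℚ × ℚ // r.1 < r.2}) : Set C(Ω, ℝ) :=
    {f | ∃ E ∈ Set.Ioo (r.1.1 : ℝ) r.1.2,
      (E : ℂ) ∉ spectrum ℂ (schrodingerOp (sampledPotential T f 1))}
  have hUo (r) : IsOpen (U r) := by
    have h : U r = ⋃ E ∈ Set.Ioo (r.1.1 : ℝ) r.1.2, (fun f => sampledPotential T f 1) ⁻¹'
        {V | (E : ℂ) ∉ spectrum ℂ (schrodingerOp V)} := by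
      ext f
      simp [U]
    rw [h]
    exact isOpen_biUnion fun E _ =>
      (isOpen_setOf_not_mem_spectrum _).preimage (continuous_sampledPotential T 1)
  have hUd (r) : Dense (U r) := by
    refine Metric.dense_iff.2 fun f ε hε => ?_
    obtain ⟨h, hh, hE⟩ := exists_near_gap hT f hε
      (by exact_mod_cast r.2 : (r.1.1 : ℝ) < r.1.2)
    exact ⟨h, by rwa [Metric.mem_ball, dist_eq_norm], hE⟩
  refine ⟨⋂ r, U r, dense_iInter_of_isOpen hUo hUd, IsGδ.iInter_of_isOpen hUo, ?_⟩
  intro f hf ω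
  set H := schrodingerOp (sampledPotential T f ω) with hH
  have himg : spectrum ℂ H = (fun x : ℝ => (x : ℂ)) '' ((fun x : ℝ => (x : ℂ)) ⁻¹' spectrum ℂ H) := by
    rw [Set.image_preimage_eq_of_subset]
    intro z hz
    exact ⟨z.re, ((isSelfAdjoint_schrodingerOp _).mem_spectrum_eq_re hz).symm⟩
  refine ⟨(fun x : ℝ => (x : ℂ)) ⁻¹' spectrum ℂ H, ⟨?_, ?_, ?_, ?_⟩, himg⟩
  · have h := spectrum.nonempty H
    rw [himg] at h
    exact h.of_image
  · exact Complex.isometry_ofReal.isClosedEmbedding.isCompact_preimage (spectrum.isCompact H)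
  · rw [Set.eq_empty_iff_forall_notMem]
    intro x hx
    obtain ⟨l, u, hxlu, hlu⟩ := mem_nhds_iff_exists_Ioo_subset.1 (mem_interior_iff_mem_nhds.1 hx)
    obtain ⟨r₁, hr₁, hr₁'⟩ := exists_rat_btwn hxlu.1
    obtain ⟨r₂, hr₂, hr₂'⟩ := exists_rat_btwn hxlu.2
    obtain ⟨E, hE, hEs⟩ := Set.mem_iInter.1 hf
      ⟨(r₁, r₂), by exact_mod_cast hr₁'.trans hr₂⟩
    refine hEs ?_
    rw [spectrum_sampledPotential_eq hT f 1 ω]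
    exact hlu ⟨hr₁.trans hE.1, hE.2.trans hr₂'⟩
  · intro x hx
    refine AccPt.of_ofReal_image ?_
    rw [← himg]
    exact accPt_spectrum_of_recurrent (fun ε hε => sampledPotential_recurrent hT f ω hε) hx
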